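/- An idiom is a complete lattice $A$ (bottom $0$, top $1$) that is modular and upper continuous ($a\wedge\bigvee X=\bigvee_{x\in X}(a\wedge x)$ for $a\in A$ and directed $X\subseteq A$). A nucleus on $A$ is an inflationary, idempotent map $j\colon A\to A$ that preserves binary meets; ordered pointwise, the nuclei form a frame $N(A)$, and $\neg$ denotes its pseudocomplement. Intervals $[a,b]$ are taken with $a\le b$. Two intervals are similar if one is $[l,l\vee r]$ and the other is $[l\wedge r,r]$ for some $l,r\in A$, and projective if a finite chain of similarities links them. For $a\le x\le b$, the element $x$ is essential in $[a,b]$ if $x\wedge y=a$ with $a\le y\le b$ implies $y=a$. An interval $[a,b]$ is simple if $a<b$ and no $x$ satisfies $a<x<b$; the idiom $A$ is weakly atomic if for all $c<d$ in $A$ there are $c\le x<y\le d$ with $[x,y]$ simple. A division set is a nonempty set $\mathcal D$ of intervals, closed under similarity and subintervals, such that $[a,b],[b,c]\in\mathcal D$ implies $[a,c]\in\mathcal D$, and such that $[a,\bigvee X]\in\mathcal D$ whenever $X\subseteq\{x\in A: x\ge a\}$, $a\le\bigvee X$, and $[a,x]\in\mathcal D$ for all $x\in X$. For $j\in N(A)$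 let $\mathcal D_j=\{[a,b]: b\le j(a)\}$, which is a division set. Let $\chi(a,b)$ be the largest nucleus $k$ with $k(a)\wedge b=a$, and let $\mathcal F_j=\{[a,b]: j\le\chi(a,b)\}$. The nucleus $j$ is DDF if the division set $\mathcal D=\mathcal D_j$ is stable (if $[a,b]\in\mathcal D$, $b\le c$ and $b$ is essential in $[a,c]$, then $[a,c]\in\mathcal D$) and satisfies: if $[x,a]\in\mathcal D$ for all $x\in X$, then $[\bigwedge X,a]\in\mathcal D$ (for $a\in A$, $X\subseteq A$ with $\bigwedge X\le a$). An interval $[a,b]$ is nonsingular if, whenever $[c,d]$ is projective to $[a,x]$ for some $a\le x\le b$ and $c$ is essential in $[0,d]$, then $c=d$. The Goldie nucleus $\zeta$ is the unique nucleus for which $\mathcal F_\zeta$ is the set of all nonsingular intervals. The Goldman nucleus $\xi_{sp}$ is the least nucleus $j$ such that $\mathcal D_j$ contains every nonsingular simple interval. **Proposition.** Let $A$ be a weakly atomic idiom. Then $\zeta$ is DDF if and only if $\neg\xi_{sp}=\zeta$. -/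

import Mathlib

/-- An idiom: a complete lattice which is modular and upper continuous. -/
class IsIdiom (A : Type*) [CompleteLattice A] : Prop extends IsModularLattice A where
  inf_sSup_eq : ∀ (a : A) (X : Set A), DirectedOn (· ≤ ·) X → a ⊓ sSup X = ⨆ x ∈ X, a ⊓ x

namespace IdiomTheory

section Intervals

variable {A : Type*} [CompleteLattice A]

/-- The interval `[a, b]`, for `a ≤ b`. The order on `NonemptyInterval A` is inclusion, so that
`J ≤ I` says that `J` is a subinterval of `I`. -/
def ival (a b : A) (h : a ≤ b) : NonemptyInterval A := ⟨(a, b), h⟩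

/-- Similarity of intervals: one of them is `[l, l ⊔ r]` and the other one is `[l ⊓ r, r]`. -/
def Similar (J I : NonemptyInterval A) : Prop :=
  ∃ l r : A,
    (J = ival l (l ⊔ r) le_sup_left ∧ I = ival (l ⊓ r) r inf_le_right) ∨
    (J = ival (l ⊓ r) r inf_le_right ∧ I = ival l (l ⊔ r) le_sup_left)

/-- Projectivity of intervals: they are linked by a finite chain of similarities. -/
def Projective : NonemptyInterval A → NonemptyInterval A → Prop :=
  Relation.TransGen Similar

def IsAbstract (D : Set (NonemptyInterval A)) : Prop :=
  D.Nonempty ∧ ∀ I J, Similar J I → I ∈ D → J ∈ D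

def IsBasic (D : Set (NonemptyInterval A)) : Prop :=
  IsAbstract D ∧ ∀ I J, J ≤ I → I ∈ D → J ∈ D

def IsCongruenceSet (D : Set (NonemptyInterval A)) : Prop :=
  IsBasic D ∧ ∀ (a b c : A) (hab : a ≤ b) (hbc : b ≤ c),
    ival a b hab ∈ D → ival b c hbc ∈ D → ival a c (hab.trans hbc) ∈ D

def IsPreDivisionSet (D : Set (NonemptyInterval A)) : Prop :=
  IsBasic D ∧ ∀ (a : A) (X : Set A) (ha : a ≤ sSup X),
    (∀ x ∈ X, ∃ h : a ≤ x, ival a x h ∈ D) → ival a (sSup X) ha ∈ D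

def IsDivisionSet (D : Set (NonemptyInterval A)) : Prop :=
  IsCongruenceSet D ∧ IsPreDivisionSet D

/-- `x` is an essential element of the interval `I = [a, b]`. -/
def IsEssentialIn (x : A) (I : NonemptyInterval A) : Prop :=
  (I.fst ≤ x ∧ x ≤ I.snd) ∧
    ∀ y, I.fst ≤ y → y ≤ I.snd → x ⊓ y = I.fst → y = I.fst

/-- `[a, b]` is a (nontrivial) simple interval: `a < b` and nothing lies strictly between. -/
def IsSimpleInterval (I : NonemptyInterval A) : Prop := I.fst ⋖ I.snd

def IsWeaklyAtomicInterval (I : NonemptyInterval A) : Prop :=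
  ∀ c d : A, I.fst ≤ c → c < d → d ≤ I.snd →
    ∃ (x y : A) (h : x ≤ y), c ≤ x ∧ y ≤ d ∧ IsSimpleInterval (ival x y h)

/-- A division set is stable if it is closed under essential extensions. -/
def IsStableSet (D : Set (NonemptyInterval A)) : Prop :=
  ∀ (a b c : A) (hab : a ≤ b) (hbc : b ≤ c), ival a b hab ∈ D →
    IsEssentialIn b (ival a c (hab.trans hbc)) → ival a c (hab.trans hbc) ∈ D

/-- Division-division-free sets. -/
def IsDDFSet (D : Set (NonemptyInterval A)) : Prop :=
  IsDivisionSet D ∧ IsStableSet D ∧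
    ∀ (X : Set A) (a : A) (ha : sInf X ≤ a),
      (∀ x ∈ X, ∃ h : x ≤ a, ival x a h ∈ D) → ival (sInf X) a ha ∈ D

/-- The set `𝓓_j` of the intervals `[a, b]` collapsed by `j`, i.e. with `b ≤ j a`. -/
def collapsed (j : Nucleus A) : Set (NonemptyInterval A) :=
  {I | I.snd ≤ j I.fst}

def IsDDF (j : Nucleus A) : Prop := IsDDFSet (collapsed j)

/-- `χ(a, b)`, the largest nucleus `j` with `j a ⊓ b = a` (see `isGreatest_chi`). -/
def chi (I : NonemptyInterval A) : Nucleus A :=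
  sSup {j | j I.fst ⊓ I.snd = I.fst}

/-- The division free set `𝓕_j` of `j`. -/
def free (j : Nucleus A) : Set (NonemptyInterval A) :=
  {I | j ≤ chi I}

/-- `ξ_C`, the least nucleus that collapses every interval in `C`. -/
def xi (C : Set (NonemptyInterval A)) : Nucleus A :=
  sInf {j | C ⊆ collapsed j}

/-- `¬ j`, the pseudocomplement of `j` in the frame of nuclei (see `isGreatest_neg`). -/
def neg (j : Nucleus A) : Nucleus A :=
  sSup {k | k ⊓ j = ⊥}

/-- `[a, b]` is nonsingular: if an initial part `[a, x]` of it is projective to some `[c, d]` with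
`c` essential in `[0, d]`, then `c = d`. -/
def IsNonsingular (I : NonemptyInterval A) : Prop :=
  ∀ (c d x : A) (hcd : c ≤ d) (hx : I.fst ≤ x), x ≤ I.snd →
    Projective (ival c d hcd) (ival I.fst x hx) → IsEssentialIn c (ival ⊥ d bot_le) → c = d

/-- The set `𝔊(A)` of all nonsingular intervals. -/
def nonsingular (A : Type*) [CompleteLattice A] : Set (NonemptyInterval A) :=
  {I | IsNonsingular I}

/-- `ξ_sp`, the nucleus generated by the nonsingular simple intervals. -/
def goldman (A : Type*) [CompleteLattice A] : Nucleus A :=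
  xi {I | IsNonsingular I ∧ IsSimpleInterval I}

/-- An idiom is weakly atomic if each of its intervals is. -/
def IsWeaklyAtomicIdiom (A : Type*) [CompleteLattice A] : Prop :=
  ∀ I : NonemptyInterval A, IsWeaklyAtomicInterval I

end Intervals

/-! Helper facts, which show that the nuclei named above exist and are what they should be. -/

section Facts

variable {A : Type*} [CompleteLattice A]

theorem similar_symm {I J : NonemptyInterval A} (h : Similar I J) : Similar J I := by
  obtain ⟨l, r, h | h⟩ := h
  · exact ⟨l, r, Or.inr ⟨h.2, h.1⟩⟩
  · exact ⟨l, r, Or.inl ⟨h.2, h.1⟩⟩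

theorem similar_refl (I : NonemptyInterval A) : Similar I I := by
  obtain ⟨⟨a, b⟩, h⟩ := I
  have h' : a ≤ b := h
  refine ⟨a, b, Or.inl ⟨?_, ?_⟩⟩ <;> simp [ival, h']

theorem ival_congr {a b a' b' : A} {h : a ≤ b} (ha : a = a') (hb : b = b') :
    ival a b h = ival a' b' (ha ▸ hb ▸ h) := by
  subst ha; subst hb; rfl

theorem ival_le {a b a' b' : A} {h : a ≤ b} {h' : a' ≤ b'} (ha : a ≤ a') (hb : b' ≤ b) :
    ival a' b' h' ≤ ival a b h :=
  NonemptyInterval.le_def.2 ⟨ha, hb⟩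

theorem projective_symm {I J : NonemptyInterval A} (h : Projective I J) : Projective J I := by
  induction h using Relation.TransGen.head_induction_on with
  | single h => exact Relation.TransGen.single (similar_symm h)
  | head h _ ih => exact Relation.TransGen.tail ih (similar_symm h)

theorem mem_collapsed {j : Nucleus A} {a b : A} {h : a ≤ b} :
    ival a b h ∈ collapsed j ↔ b ≤ j a := Iff.rfl

theorem collapsed_similar [IsModularLattice A] (j : Nucleus A) {I J : NonemptyInterval A}
    (h : Similar J I) (hI : I ∈ collapsed j) : J ∈ collapsed j := by
  obtain ⟨l, r, ⟨rfl, rfl⟩ | ⟨rfl, rfl⟩⟩ := h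
  · rw [mem_collapsed] at hI ⊢
    exact sup_le j.le_apply (hI.trans (j.monotone inf_le_left))
  · rw [mem_collapsed] at hI ⊢
    rw [j.map_inf]
    exact le_inf (le_sup_right.trans hI) j.le_apply

theorem collapsed_projective [IsModularLattice A] (j : Nucleus A) {I J : NonemptyInterval A}
    (h : Projective J I) (hI : I ∈ collapsed j) : J ∈ collapsed j := by
  induction h using Relation.TransGen.head_induction_on with
  | single h => exact collapsed_similar j h hI
  | head h _ ih => exact collapsed_similar j h ih

theorem collapsed_sub (j : Nucleus A) {I J : NonemptyInterval A}
    (h : J ≤ I) (hI : I ∈ collapsed j) : J ∈ collapsed j := by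
  rw [NonemptyInterval.le_def] at h
  exact h.2.trans (le_trans hI (j.monotone h.1))

theorem le_of_collapsed_subset {j k : Nucleus A} (h : collapsed j ⊆ collapsed k) : j ≤ k :=
  fun a => h (show ival a (j a) j.le_apply ∈ collapsed j from le_rfl)

/-- Every division set is the set of intervals collapsed by a nucleus. -/
theorem exists_nucleus (D : Set (NonemptyInterval A)) (hD : IsDivisionSet D) :
    ∃ j : Nucleus A, collapsed j = D := by
  obtain ⟨⟨⟨⟨-, hsim⟩, hsub⟩, hext⟩, -, hsup⟩ := hD
  let S : A → Set A := fun a => {x | ∃ h : a ≤ x, ival a x h ∈ D}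
  have up : ∀ l r h h', ival (l ⊓ r) r h ∈ D → ival l (l ⊔ r) h' ∈ D := fun l r h h' hm =>
    hsim _ _ ⟨l, r, Or.inl ⟨rfl, rfl⟩⟩ hm
  have dn : ∀ l r h h', ival l (l ⊔ r) h' ∈ D → ival (l ⊓ r) r h ∈ D := fun l r h h' hm =>
    hsim _ _ ⟨l, r, Or.inr ⟨rfl, rfl⟩⟩ hm
  have sub : ∀ a b a' b' h h', a ≤ a' → b' ≤ b → ival a b h ∈ D → ival a' b' h' ∈ D :=
    fun a b a' b' h h' h1 h2 hm => hsub _ _ (ival_le h1 h2) hm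
  have triv : ∀ a, ival a a le_rfl ∈ D := by
    intro a
    have h0 : ival (⊥ : A) ⊥ le_rfl ∈ D := by
      have := hsup ⊥ ∅ bot_le (by simp)
      exact sub _ _ _ _ _ _ le_rfl bot_le this
    have := up a ⊥ inf_le_right le_sup_left (by
      rw [ival_congr (a' := ⊥) (b' := ⊥) (by simp) rfl]; exact h0)
    rw [ival_congr (a' := a) (b' := a) rfl (by simp)] at this
    exact this
  have le : ∀ a, a ≤ sSup (S a) := fun a => le_sSup ⟨le_rfl, triv a⟩
  have mem : ∀ a, ival a (sSup (S a)) (le a) ∈ D := fun a => hsup a _ (le a) (fun x hx => hx)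
  have mono : ∀ a b, a ≤ b → sSup (S a) ≤ sSup (S b) := by
    intro a b hab
    refine sSup_le ?_
    rintro x ⟨h, hx⟩
    have h1 : ival (b ⊓ x) x inf_le_right ∈ D := sub _ _ _ _ _ _ (le_inf hab h) le_rfl hx
    exact le_sup_right.trans (le_sSup ⟨le_sup_left, up b x _ _ h1⟩)
  have key : ∀ a r, r ≤ sSup (S a) → ival (a ⊓ r) r inf_le_right ∈ D := fun a r hr =>
    dn a r _ le_sup_left (sub _ _ _ _ _ _ le_rfl (sup_le (le a) hr) (mem a))
  let j : Nucleus A :=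
    { toFun := fun a => sSup (S a)
      map_inf' := by
        intro a b
        refine le_antisymm (le_inf (mono _ _ inf_le_left) (mono _ _ inf_le_right)) ?_
        have h1 := key a (sSup (S a) ⊓ sSup (S b)) inf_le_left
        have h2 := key b (a ⊓ (sSup (S a) ⊓ sSup (S b)))
          (inf_le_right.trans inf_le_right)
        refine le_sSup ⟨inf_le_inf (le a) (le b), ?_⟩
        have h3 := hext _ _ _ _ _ h2 h1
        refine sub _ _ _ _ _ _ ?_ le_rfl h3
        exact le_of_eq_of_le (by ac_rfl) (inf_le_right : (sSup (S a) ⊓ sSup (S b)) ⊓ (a ⊓ b) ≤ _)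
      idempotent' := by
        intro a
        exact le_sSup ⟨(le a).trans (le _), hext _ _ _ _ _ (mem a) (mem _)⟩
      le_apply' := le }
  refine ⟨j, Set.ext fun I => ?_⟩
  obtain ⟨⟨a, b⟩, h⟩ := I
  have h' : a ≤ b := h
  constructor
  · intro hI
    exact sub _ _ _ _ _ h' le_rfl hI (mem a)
  · intro hI
    exact le_sSup (show b ∈ S a from ⟨h', hI⟩)

/-- The intervals that have no nontrivial subinterval in `P`. -/
def torsion (P : Set (NonemptyInterval A)) : Set (NonemptyInterval A) :=
  {I | ∀ J, J ≤ I → J ∈ P → J.fst = J.snd}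

theorem torsion_ival {P : Set (NonemptyInterval A)} {a b : A} {h : a ≤ b} :
    ival a b h ∈ torsion P ↔
      ∀ (u v : A) (huv : u ≤ v), a ≤ u → v ≤ b → ival u v huv ∈ P → u = v := by
  constructor
  · intro hI u v huv h1 h2 hP
    exact hI _ (ival_le h1 h2) hP
  · rintro hI ⟨⟨u, v⟩, huv⟩ hJ hP
    rw [NonemptyInterval.le_def] at hJ
    exact hI u v huv hJ.1 hJ.2 hP

theorem isDivisionSet_torsion [IsIdiom A] (P : Set (NonemptyInterval A))
    (hsim : ∀ I J, Similar J I → I ∈ P → J ∈ P)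
    (hini : ∀ (a x b : A) (h : a ≤ x) (h' : x ≤ b),
      ival a b (h.trans h') ∈ P → ival a x h ∈ P) :
    IsDivisionSet (torsion P) := by
  have simil : ∀ I J, Similar J I → I ∈ torsion P → J ∈ torsion P := by
    rintro I J ⟨l, r, ⟨rfl, rfl⟩ | ⟨rfl, rfl⟩⟩ hI
    · rw [torsion_ival] at hI ⊢
      intro u v huv hu hv hP
      have e1 : u ⊔ r ⊓ v = v := by
        rw [← sup_inf_assoc_of_le r huv]
        exact inf_eq_right.2 (hv.trans (sup_le_sup_right hu r))
      have e2 : u ⊓ (r ⊓ v) = r ⊓ u := by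
        rw [inf_comm r v, ← inf_assoc, inf_eq_left.2 huv, inf_comm]
      have h1 : ival (u ⊓ (r ⊓ v)) (r ⊓ v) inf_le_right ∈ P :=
        hsim _ _ ⟨u, r ⊓ v, Or.inr ⟨rfl, rfl⟩⟩
          (by rw [ival_congr (a' := u) (b' := v) rfl e1]; exact hP)
      have h2 := hI _ _ _ (by rw [e2, inf_comm r u]; exact inf_le_inf_right r hu)
        inf_le_left h1
      rw [← e1, ← h2]; exact (sup_eq_left.2 inf_le_left).symm
    · rw [torsion_ival] at hI ⊢
      intro u v huv hu hv hP
      have e : (u ⊔ l) ⊓ v = u := by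
        rw [sup_inf_assoc_of_le l huv]
        exact sup_eq_left.2 ((inf_le_inf_left l hv).trans hu)
      have h1 : ival (u ⊔ l) (u ⊔ l ⊔ v) le_sup_left ∈ P :=
        hsim _ _ ⟨u ⊔ l, v, Or.inl ⟨rfl, rfl⟩⟩
          (by rw [ival_congr (a' := u) (b' := v) e rfl]; exact hP)
      have h2 := hI _ _ _ le_sup_right
        (sup_le (sup_le ((huv.trans hv).trans le_sup_right) le_sup_left)
          (hv.trans le_sup_right)) h1
      rw [← e]; exact inf_eq_right.2 (le_of_le_of_eq le_sup_right h2.symm)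
  have sub : ∀ I J, J ≤ I → I ∈ torsion P → J ∈ torsion P :=
    fun I J hJ hI K hK => hI K (hK.trans hJ)
  have triv : ∀ a, ival a a le_rfl ∈ torsion P := fun a =>
    torsion_ival.2 fun u v huv hu hv _ => le_antisymm huv (hv.trans hu)
  have cut : ∀ (a b u : A) (hab : a ≤ b), ival a b hab ∈ torsion P → a ≤ u →
      ival u (u ⊔ b) le_sup_left ∈ torsion P := by
    intro a b u hab hm hu
    refine simil _ _ ⟨u, b, Or.inl ⟨rfl, rfl⟩⟩ (sub _ _ ?_ hm)
    exact ival_le (le_inf hu hab) le_rfl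
  have ext : ∀ (a b c : A) (hab : a ≤ b) (hbc : b ≤ c), ival a b hab ∈ torsion P →
      ival b c hbc ∈ torsion P → ival a c (hab.trans hbc) ∈ torsion P := by
    intro a b c hab hbc h1 h2
    rw [torsion_ival]
    intro u v huv hu hv hP
    have h3 := hini u (v ⊓ (u ⊔ b)) v (le_inf huv le_sup_left) inf_le_left hP
    have h4 := torsion_ival.1 (cut a b u hab h1 hu) _ _ _ le_rfl inf_le_right h3
    have h5 : ival (u ⊔ b) (u ⊔ b ⊔ v) le_sup_left ∈ P :=
      hsim _ _ ⟨u ⊔ b, v, Or.inl ⟨rfl, rfl⟩⟩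
        (by rw [ival_congr (a' := u) (b' := v) (by rw [inf_comm]; exact h4.symm) rfl]; exact hP)
    have h6 := torsion_ival.1 h2 _ _ _ le_sup_right
      (sup_le (sup_le (huv.trans hv) hbc) hv) h5
    rw [h4]; exact inf_eq_left.2 (le_of_le_of_eq le_sup_right h6.symm)
  refine ⟨⟨⟨⟨⟨_, triv ⊥⟩, simil⟩, sub⟩, ext⟩, ⟨⟨⟨_, triv ⊥⟩, simil⟩, sub⟩, ?_⟩
  intro a X ha hX
  rw [torsion_ival]
  intro u v huv hu hv hP
  let T : Set A := {t | ∃ h : u ≤ t, ival u t h ∈ torsion P}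
  have hT : DirectedOn (· ≤ ·) T := by
    rintro s ⟨hs, hs'⟩ t ⟨ht, ht'⟩
    refine ⟨s ⊔ t, ⟨hs.trans le_sup_left, ?_⟩, le_sup_left, le_sup_right⟩
    exact ext _ _ _ hs le_sup_left hs' (cut u t s ht ht' hs)
  have hvT : v ≤ sSup T := by
    refine hv.trans (sSup_le fun x hx => ?_)
    obtain ⟨h, hx'⟩ := hX x hx
    exact le_sup_right.trans (le_sSup ⟨le_sup_left, cut a x u h hx' hu⟩)
  have e : v = ⨆ t ∈ T, v ⊓ t := by
    rw [← IsIdiom.inf_sSup_eq v T hT]; exact (inf_eq_left.2 hvT).symm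
  refine le_antisymm huv ?_
  rw [e]
  refine iSup₂_le ?_
  rintro t ⟨ht, ht'⟩
  have h1 := hini u (v ⊓ t) v (le_inf huv ht) inf_le_left hP
  exact (torsion_ival.1 ht' _ _ _ le_rfl inf_le_right h1).symm.le

theorem exists_torsion_nucleus [IsIdiom A] (P : Set (NonemptyInterval A))
    (hsim : ∀ I J, Similar J I → I ∈ P → J ∈ P)
    (hini : ∀ (a x b : A) (h : a ≤ x) (h' : x ≤ b),
      ival a b (h.trans h') ∈ P → ival a x h ∈ P) :
    ∃ j : Nucleus A, collapsed j = torsion P :=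
  exists_nucleus _ (isDivisionSet_torsion P hsim hini)

theorem initial_of_projective [IsIdiom A] {I J : NonemptyInterval A} (h : Projective J I)
    (x : A) (h1 : J.fst ≤ x) (h2 : x ≤ J.snd) :
    ∃ (y : A) (hy : I.fst ≤ y), y ≤ I.snd ∧ Projective (ival J.fst x h1) (ival I.fst y hy) := by
  have step : ∀ I J : NonemptyInterval A, Similar J I → ∀ (x : A) (h1 : J.fst ≤ x), x ≤ J.snd →
      ∃ (y : A) (hy : I.fst ≤ y), y ≤ I.snd ∧ Similar (ival J.fst x h1) (ival I.fst y hy) := by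
    rintro I J ⟨l, r, ⟨rfl, rfl⟩ | ⟨rfl, rfl⟩⟩ x h1 h2
    · change l ≤ x at h1
      change x ≤ l ⊔ r at h2
      refine ⟨r ⊓ x, le_inf inf_le_right (inf_le_left.trans h1), inf_le_left,
        l, r ⊓ x, Or.inl ⟨?_, ?_⟩⟩
      · exact ival_congr rfl (by
          rw [← sup_inf_assoc_of_le r h1]; exact (inf_eq_right.2 h2).symm)
      · refine ival_congr ?_ rfl
        change l ⊓ r = l ⊓ (r ⊓ x)
        rw [← inf_assoc]; exact (inf_eq_left.2 (inf_le_left.trans h1)).symm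
    · change l ⊓ r ≤ x at h1
      change x ≤ r at h2
      refine ⟨l ⊔ x, le_sup_left, sup_le_sup_left h2 l, l, x, Or.inr ⟨?_, rfl⟩⟩
      exact ival_congr (le_antisymm (le_inf inf_le_left h1) (inf_le_inf_left l h2)) rfl
  induction h using Relation.TransGen.head_induction_on generalizing x with
  | single h =>
    obtain ⟨y, hy, hy', hs⟩ := step _ _ h x h1 h2
    exact ⟨y, hy, hy', Relation.TransGen.single hs⟩
  | head h _ ih =>
    obtain ⟨y, hy, hy', hs⟩ := step _ _ h x h1 h2
    obtain ⟨z, hz, hz', hp⟩ := ih y hy hy'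
    exact ⟨z, hz, hz', Relation.TransGen.head hs hp⟩

theorem chi_aux [IsIdiom A] (I : NonemptyInterval A) :
    ∃ k : Nucleus A, IsGreatest {j : Nucleus A | j I.fst ⊓ I.snd = I.fst} k := by
  let P : Set (NonemptyInterval A) :=
    {J | ∃ (y : A) (hy : I.fst ≤ y), y ≤ I.snd ∧ Projective J (ival I.fst y hy)}
  obtain ⟨k, hk⟩ := exists_torsion_nucleus P
    (by
      rintro J K h ⟨y, hy, hy', hp⟩
      exact ⟨y, hy, hy', Relation.TransGen.head h hp⟩)
    (by
      rintro a x b h h' ⟨y, hy, hy', hp⟩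
      obtain ⟨z, hz, hz', hp'⟩ := initial_of_projective hp x h h'
      exact ⟨z, hz, hz'.trans hy', hp'⟩)
  refine ⟨k, ?_, ?_⟩
  · have hle : I.fst ≤ k I.fst ⊓ I.snd := le_inf k.le_apply I.fst_le_snd
    have h1 : ival I.fst (k I.fst ⊓ I.snd) hle ∈ collapsed k := mem_collapsed.2 inf_le_left
    rw [hk] at h1
    exact (torsion_ival.1 h1 _ _ hle le_rfl le_rfl
      ⟨_, hle, inf_le_right, Relation.TransGen.single (similar_refl _)⟩).symm
  · intro j hj
    apply le_of_collapsed_subset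
    rw [hk]
    rintro J hJ K hK ⟨y, hy, hy', hp⟩
    have h1 := collapsed_sub j hK hJ
    have hsymm : Projective (ival I.fst y hy) K := projective_symm hp
    have h2 : y ≤ j I.fst := collapsed_projective j hsymm h1
    have h3 : y = I.fst := le_antisymm (le_of_le_of_eq (le_inf h2 hy') hj) hy
    have h4 : ival I.fst y hy ∈ collapsed (⊥ : Nucleus A) := h3.le
    exact le_antisymm K.fst_le_snd (collapsed_projective ⊥ hp h4)

theorem isGreatest_chi [IsIdiom A] (I : NonemptyInterval A) :
    IsGreatest {j : Nucleus A | j I.fst ⊓ I.snd = I.fst} (chi I) := by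
  obtain ⟨k, hk⟩ := chi_aux I
  have : chi I = k := hk.isLUB.sSup_eq
  rw [this]; exact hk

theorem mem_free [IsIdiom A] {j : Nucleus A} {I : NonemptyInterval A} :
    I ∈ free j ↔ j I.fst ⊓ I.snd = I.fst := by
  constructor
  · intro h
    refine le_antisymm ?_ (le_inf j.le_apply I.fst_le_snd)
    calc j I.fst ⊓ I.snd ≤ chi I I.fst ⊓ I.snd := inf_le_inf_right _ (h I.fst)
      _ = I.fst := (isGreatest_chi I).1
  · intro h
    exact (isGreatest_chi I).2 h

theorem isGreatest_neg [IsIdiom A] (j : Nucleus A) :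
    IsGreatest {k : Nucleus A | k ⊓ j = ⊥} (neg j) := by
  obtain ⟨k, hk⟩ := exists_torsion_nucleus (collapsed j)
    (fun I J => collapsed_similar j)
    (fun a x b h h' hm => collapsed_sub j (ival_le le_rfl h') hm)
  have hg : IsGreatest {k : Nucleus A | k ⊓ j = ⊥} k := by
    constructor
    · refine Nucleus.ext fun a => ?_
      have hle : a ≤ k a ⊓ j a := le_inf k.le_apply j.le_apply
      have h1 : ival a (k a ⊓ j a) hle ∈ collapsed k := mem_collapsed.2 inf_le_left
      rw [hk] at h1
      exact (torsion_ival.1 h1 _ _ hle le_rfl le_rfl (mem_collapsed.2 inf_le_right)).symm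
    · intro i hi
      apply le_of_collapsed_subset
      rw [hk]
      intro J hJ K hK hKj
      have h1 : K.snd ≤ (i ⊓ j) K.fst := le_inf (collapsed_sub i hK hJ) hKj
      rw [show i ⊓ j = ⊥ from hi] at h1
      exact le_antisymm K.fst_le_snd h1
  have : neg j = k := hg.isLUB.sSup_eq
  rw [this]; exact hg

/-- A nucleus is determined by its division free set. -/
theorem free_injective [IsIdiom A] : Function.Injective (free (A := A)) := by
  have aux : ∀ j k : Nucleus A, free j = free k → j ≤ k := by
    intro j k h a
    have h1 : ival (k a) ⊤ le_top ∈ free k := mem_free.2 (by simp [ival])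
    rw [← h, mem_free] at h1
    have h2 : j (k a) = k a := by simpa [ival] using h1
    exact (j.monotone k.le_apply).trans h2.le
  exact fun j k h => le_antisymm (aux j k h) (aux k j h.symm)

/-- There is a nucleus whose division free set is the set of nonsingular intervals. -/
theorem exists_goldie (A : Type*) [CompleteLattice A] [IsIdiom A] :
    ∃ j : Nucleus A, free j = nonsingular A := by
  have pbot : ∀ I J : NonemptyInterval A, Projective I J → J.fst = J.snd → I.fst = I.snd :=
    fun I J h e => le_antisymm I.fst_le_snd
      (collapsed_projective ⊥ h (show J ∈ collapsed ⊥ from e.ge))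
  have hsim : ∀ I J : NonemptyInterval A, Similar J I → I ∈ nonsingular A →
      J ∈ nonsingular A := by
    intro I J h hI c d x hcd hx hx' hp he
    obtain ⟨y, hy, hy', hp'⟩ := initial_of_projective (Relation.TransGen.single h) x hx hx'
    exact hI c d y hcd hy hy' (hp.trans hp') he
  obtain ⟨j, hj⟩ := exists_torsion_nucleus (nonsingular A) hsim
    (fun a x b h h' hm c d y hcd hy hy' => hm c d y hcd hy (hy'.trans h'))
  refine ⟨j, Set.ext fun I => ?_⟩
  rw [mem_free]
  have hle : I.fst ≤ j I.fst ⊓ I.snd := le_inf j.le_apply I.fst_le_snd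
  constructor
  · intro hI c d x hcd hx hx' hp he
    have h1 : ival c d hcd ∈ collapsed j := by
      rw [hj, torsion_ival]
      intro u v huv hu hv hm
      refine hm u v v huv huv le_rfl (Relation.TransGen.single (similar_refl _)) ?_
      refine ⟨⟨bot_le, huv⟩, fun y _ hy e => he.2 y bot_le (le_trans hy hv) ?_⟩
      exact le_bot_iff.1 (le_of_le_of_eq (inf_le_inf_right y hu) e)
    have h2 : x ≤ j I.fst := collapsed_projective j (projective_symm hp) h1
    exact pbot _ _ hp (le_antisymm hx (le_of_le_of_eq (le_inf h2 hx') hI))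
  · intro hI
    have h1 : ival I.fst (j I.fst ⊓ I.snd) hle ∈ collapsed j := mem_collapsed.2 inf_le_left
    rw [hj] at h1
    exact (torsion_ival.1 h1 _ _ hle le_rfl le_rfl
      (fun c d y hcd hy hy' => hI c d y hcd hy (le_trans hy' inf_le_right))).symm

end Facts

/-- The Goldie nucleus `ζ`: the nucleus whose division free set is `𝔊(A)`. -/
noncomputable def goldie (A : Type*) [CompleteLattice A] [IsIdiom A] : Nucleus A :=
  Classical.choose (exists_goldie A)

theorem free_goldie (A : Type*) [CompleteLattice A] [IsIdiom A] :
    free (goldie A) = nonsingular A :=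
  Classical.choose_spec (exists_goldie A)

/-- If already the intervals that are nonsingular with respect to similarity (instead of
projectivity) form the division free set of a nucleus, then they are exactly the nonsingular
intervals and this nucleus is the Goldie nucleus. -/
theorem eq_goldie_of_similar {A : Type*} [CompleteLattice A] [IsIdiom A] (j : Nucleus A)
    (hj : free j = {I | ∀ (c d x : A) (hcd : c ≤ d) (hx : I.fst ≤ x), x ≤ I.snd →
      Similar (ival c d hcd) (ival I.fst x hx) → IsEssentialIn c (ival ⊥ d bot_le) → c = d}) :
    j = goldie A ∧ free j = nonsingular A := by
  suffices h : free j = nonsingular A from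
    ⟨free_injective (h.trans (free_goldie A).symm), h⟩
  refine Set.Subset.antisymm ?_ ?_
  · intro I hI c d x hcd hx hx' hp he
    have hess : ∀ c d : A, ∀ hcd : c ≤ d, IsEssentialIn c (ival ⊥ d bot_le) → d ≤ j c := by
      intro c d hcd he
      have hle : j c ⊓ d ≤ d := inf_le_right
      have h1 : ival (j c ⊓ d) d hle ∈ free j := by
        rw [mem_free]
        change j (j c ⊓ d) ⊓ d = j c ⊓ d
        rw [j.map_inf, j.idempotent, inf_assoc, inf_eq_right.2 (j.le_apply (x := d))]
      rw [hj] at h1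
      have h2 := h1 (j c ⊓ d) d d hle hle le_rfl (similar_refl _)
        ⟨⟨bot_le, hle⟩, fun y _ hy e => he.2 y bot_le hy
          (le_bot_iff.1 (le_of_le_of_eq (inf_le_inf_right y (le_inf j.le_apply hcd)) e))⟩
      rw [← h2]; exact inf_le_left
    have h1 : x ≤ j I.fst :=
      collapsed_projective j (projective_symm hp) (mem_collapsed.2 (hess c d hcd he))
    have h2 : x = I.fst :=
      le_antisymm (le_of_le_of_eq (le_inf h1 hx') (mem_free.1 hI)) hx
    exact le_antisymm hcd
      (collapsed_projective ⊥ hp (show ival I.fst x hx ∈ collapsed ⊥ from h2.le))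
  · rw [hj]
    intro I hI c d x hcd hx hx' hs
    exact hI c d x hcd hx hx' (Relation.TransGen.single hs)

end IdiomTheory

/-! Two facts need no extra hypothesis. `goldie` collapses `[c, d]` whenever `c` is essential in
`[⊥, d]`; by modularity an element essential in `[a, d]` is essential in `[⊥, d]`, so the collapsed
set is stable. Moreover `goldie A ≤ neg (goldman A)`, since nonsingular intervals have no nontrivial
collapsed subinterval. Hence DDF only asks for closure under meets, and the equation only for the
reverse inequality. Both rest on `collapsed_neg_goldman` and, for simple intervals,
`isNonsingular_or_collapsed`.

DDF gives the inequality: let `[a, b]` have no nonsingular simple subinterval and let `m` be the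
least element above `a` with `[m, b]` collapsed. If `a < m`, weak atomicity yields a simple, hence
collapsed, interval inside `[a, m]`; a relative complement and stability then produce a smaller such
element.

The equation gives DDF: a nonsingular simple interval in `[⋀ X, a]` is similar to some `[⊥, y]`.
Since `y` lies below every member of `X`, it lies below `⋀ X`, a contradiction. -/

namespace IdiomTheory

/-! ### Collapsed sets, generated nuclei and pseudocomplements. -/

section Nuclei

variable {A : Type*} [CompleteLattice A]

theorem isDivisionSet_collapsed [IsModularLattice A] (j : Nucleus A) :
    IsDivisionSet (collapsed j) := by
  have hb : IsBasic (collapsed j) :=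
    ⟨⟨⟨ival ⊥ ⊥ le_rfl, mem_collapsed.2 bot_le⟩, fun _ _ => collapsed_similar j⟩,
      fun _ _ => collapsed_sub j⟩
  refine ⟨⟨hb, fun a b c hab hbc h1 h2 => ?_⟩, hb, fun a X ha hX => ?_⟩
  · rw [mem_collapsed] at *
    calc c ≤ j b := h2
      _ ≤ j (j a) := j.monotone h1
      _ = j a := j.idempotent a
  · exact mem_collapsed.2 (sSup_le fun x hx => (hX x hx).2)

theorem xi_le {C : Set (NonemptyInterval A)} {j : Nucleus A} (h : C ⊆ collapsed j) :
    xi C ≤ j :=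
  sInf_le h

theorem subset_collapsed_xi (C : Set (NonemptyInterval A)) : C ⊆ collapsed (xi C) := by
  intro I hI
  change I.snd ≤ (sInf {j : Nucleus A | C ⊆ collapsed j}) I.fst
  rw [Nucleus.sInf_apply]
  exact le_iInf₂ fun j hj => hj hI

theorem le_neg_iff [IsIdiom A] {j k : Nucleus A} : k ≤ neg j ↔ k ⊓ j = ⊥ := by
  refine ⟨fun h => ?_, fun h => (isGreatest_neg j).2 h⟩
  exact le_bot_iff.1 ((inf_le_inf_right j h).trans (isGreatest_neg j).1.le)

theorem le_neg_comm [IsIdiom A] {j k : Nucleus A} : k ≤ neg j ↔ j ≤ neg k := by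
  rw [le_neg_iff, le_neg_iff, inf_comm]

/-- The torsion set is itself the collapsed set of a nucleus `k`. An interval `[a, k a ⊓ j a]` is
collapsed by both `k` and `j`, hence trivial, so `k ⊓ j = ⊥`. -/
theorem collapsed_neg [IsIdiom A] (j : Nucleus A) :
    collapsed (neg j) = torsion (collapsed j) := by
  refine Set.Subset.antisymm (fun I hI J hJ hJj => ?_) ?_
  · have h1 : J.snd ≤ (neg j ⊓ j) J.fst := le_inf (collapsed_sub _ hJ hI) hJj
    rw [show neg j ⊓ j = ⊥ from (isGreatest_neg j).1] at h1
    exact le_antisymm J.fst_le_snd h1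
  · obtain ⟨k, hk⟩ := exists_torsion_nucleus (collapsed j)
      (fun I J => collapsed_similar j)
      (fun a x b h h' hm => collapsed_sub j (ival_le le_rfl h') hm)
    rw [← hk]
    have hkj : k ≤ neg j := by
      refine le_neg_iff.2 (Nucleus.ext fun a => ?_)
      have hle : a ≤ k a ⊓ j a := le_inf k.le_apply j.le_apply
      have h1 : ival a (k a ⊓ j a) hle ∈ collapsed k := mem_collapsed.2 inf_le_left
      rw [hk] at h1
      exact (torsion_ival.1 h1 _ _ hle le_rfl le_rfl (mem_collapsed.2 inf_le_right)).symm
    exact fun I hI => le_trans hI (hkj I.fst)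

end Nuclei

/-! ### Nonsingular and simple intervals, essential elements. -/

section Intervals

variable {A : Type*} [CompleteLattice A]

theorem nonsingular_similar [IsIdiom A] {I J : NonemptyInterval A} (h : Similar J I)
    (hI : IsNonsingular I) : IsNonsingular J := by
  intro c d x hcd hx hx' hp he
  obtain ⟨y, hy, hy', hp'⟩ := initial_of_projective (Relation.TransGen.single h) x hx hx'
  exact hI c d y hcd hy hy' (hp.trans hp') he

theorem isSimpleInterval_similar [IsModularLattice A] {I J : NonemptyInterval A}
    (h : Similar J I) (hI : IsSimpleInterval I) : IsSimpleInterval J := by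
  obtain ⟨l, r, ⟨rfl, rfl⟩ | ⟨rfl, rfl⟩⟩ := h
  · exact covBy_sup_of_inf_covBy_right hI
  · exact inf_covBy_of_covBy_sup_left hI

/-- An interval that is not trivial and lies in a simple interval is the whole of it. -/
theorem IsSimpleInterval.eq_or_eq {I J : NonemptyInterval A} (hI : IsSimpleInterval I)
    (hJ : J ≤ I) : J.fst = J.snd ∨ J = I := by
  rw [NonemptyInterval.le_def] at hJ
  have hI' : I.fst ⋖ I.snd := hI
  rcases hI'.eq_or_eq hJ.1 (J.fst_le_snd.trans hJ.2) with h1 | h1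
  · rcases hI'.eq_or_eq (hJ.1.trans J.fst_le_snd) hJ.2 with h2 | h2
    · exact Or.inl (h1.trans h2.symm)
    · exact Or.inr (NonemptyInterval.ext (Prod.ext h1 h2))
  · exact Or.inl (le_antisymm J.fst_le_snd (hJ.2.trans h1.ge))

/-- An element essential in `[a, c]` is essential in `[⊥, c]`. -/
theorem IsEssentialIn.bot [IsModularLattice A] {a b c : A} {hac : a ≤ c}
    (h : IsEssentialIn b (ival a c hac)) : IsEssentialIn b (ival ⊥ c bot_le) := by
  obtain ⟨⟨hab, hbc⟩, he⟩ := h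
  change a ≤ b at hab
  refine ⟨⟨bot_le, hbc⟩, fun y _ hy hby => ?_⟩
  change b ⊓ y = ⊥ at hby
  -- Modular law: `b ⊓ (a ⊔ y) = a ⊔ (b ⊓ y)`, as `a ≤ b`.
  have h1 : b ⊓ (a ⊔ y) = a := by
    rw [inf_comm, sup_inf_assoc_of_le y hab, inf_comm, hby, sup_bot_eq]
  have h2 : a ⊔ y = a := he _ le_sup_left (sup_le hac hy) h1
  have h3 : y ≤ b := (le_sup_right.trans h2.le).trans hab
  change y = ⊥
  rw [← hby, inf_eq_right.2 h3]

/-- Pseudocomplements relative to an interval exist in an idiom. -/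
theorem exists_maximal_inf_eq [IsIdiom A] {u v m : A} (hu : u ≤ v) (hum : u ≤ m) :
    ∃ z, Maximal (fun z => u ≤ z ∧ z ≤ m ∧ z ⊓ v = u) z := by
  obtain ⟨z, -, hz⟩ := zorn_le_nonempty₀ {z : A | u ≤ z ∧ z ≤ m ∧ z ⊓ v = u} (by
    intro c hc hch y hy
    refine ⟨sSup c, ⟨(hc hy).1.trans (le_sSup hy), sSup_le fun x hx => (hc hx).2.1, ?_⟩,
      fun x hx => le_sSup hx⟩
    refine le_antisymm ?_ (le_inf ((hc hy).1.trans (le_sSup hy)) hu)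
    -- Upper continuity carries the condition `z ⊓ v = u` over to suprema of chains.
    rw [inf_comm, IsIdiom.inf_sSup_eq v c hch.directedOn]
    exact iSup₂_le fun x hx => (inf_comm v x).trans_le (hc hx).2.2.le) u
    ⟨le_rfl, hum, inf_eq_left.2 hu⟩
  exact ⟨z, hz⟩

/-- A nonsingular simple interval is similar to `[⊥, y]` for some `y`. -/
theorem exists_similar_bot [IsModularLattice A] {u v : A} {huv : u ≤ v}
    (hn : IsNonsingular (ival u v huv)) (hs : IsSimpleInterval (ival u v huv)) :
    ∃ y, y ≤ v ∧ u ⊓ y = ⊥ ∧ u ⊔ y = v := by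
  have hs' : u ⋖ v := hs
  by_contra hcon
  -- Nonsingularity forbids `u` to be essential in `[⊥, v]`. A nonzero `y ≤ v` with `u ⊓ y = ⊥` is
  -- not below `u`, so simplicity forces `u ⊔ y = v`.
  refine hs'.ne (hn u v v huv huv le_rfl (Relation.TransGen.single (similar_refl _))
    ⟨⟨bot_le, huv⟩, fun y _ hy he => ?_⟩)
  by_contra hy0
  refine hcon ⟨y, hy, he, ?_⟩
  rcases hs'.eq_or_eq le_sup_left (sup_le huv hy) with h | h
  · have : y ≤ u := le_sup_right.trans h.le
    exact absurd ((inf_eq_right.2 this).symm.trans he) hy0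
  · exact h

end Intervals

/-! ### The Goldie nucleus and the pseudocomplement of the Goldman nucleus. -/

section Goldie

variable {A : Type*} [CompleteLattice A] [IsIdiom A]

/-- With `j = goldie A`, the interval `[j c ⊓ d, d]` is `j`-free, so nonsingular. Its lower end lies
above `c`, so it is essential in `[⊥, d]` and must equal `d`. -/
theorem le_goldie_of_isEssentialIn {c d : A} (he : IsEssentialIn c (ival ⊥ d bot_le)) :
    d ≤ goldie A c := by
  set j := goldie A
  have hcd : c ≤ d := he.1.2
  have hle : j c ⊓ d ≤ d := inf_le_right
  have h1 : ival (j c ⊓ d) d hle ∈ free j := by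
    rw [mem_free]
    change j (j c ⊓ d) ⊓ d = j c ⊓ d
    rw [j.map_inf, j.idempotent, inf_assoc, inf_eq_right.2 (j.le_apply (x := d))]
  rw [free_goldie] at h1
  have h2 := h1 (j c ⊓ d) d d hle hle le_rfl (Relation.TransGen.single (similar_refl _))
    ⟨⟨bot_le, hle⟩, fun y _ hy e => he.2 y bot_le hy
      (le_bot_iff.1 (le_of_le_of_eq (inf_le_inf_right y (le_inf j.le_apply hcd)) e))⟩
  rw [← h2]; exact inf_le_left

theorem eq_of_isNonsingular_of_collapsed {I : NonemptyInterval A} (hI : IsNonsingular I)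
    (h : I ∈ collapsed (goldie A)) : I.fst = I.snd := by
  have h1 : I ∈ free (goldie A) := by rw [free_goldie]; exact hI
  rw [mem_free, inf_eq_right.2 (show I.snd ≤ goldie A I.fst from h)] at h1
  exact h1.symm

theorem isStableSet_collapsed_goldie : IsStableSet (collapsed (goldie A)) := by
  intro a b c hab hbc h he
  rw [mem_collapsed] at h ⊢
  calc c ≤ goldie A b := le_goldie_of_isEssentialIn he.bot
    _ ≤ goldie A (goldie A a) := (goldie A).monotone h
    _ = goldie A a := (goldie A).idempotent a

/-- A simple interval is nonsingular or collapsed by the Goldie nucleus. -/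
theorem isNonsingular_or_collapsed {I : NonemptyInterval A} (hs : IsSimpleInterval I) :
    IsNonsingular I ∨ I ∈ collapsed (goldie A) := by
  by_contra! hcon
  refine hcon.1 fun c d x hcd hx hx' hp he => ?_
  -- A witness against nonsingularity gives a collapsed initial part; by simplicity this part is
  -- trivial or all of `I`.
  have h1 : ival I.fst x hx ∈ collapsed (goldie A) :=
    collapsed_projective _ (projective_symm hp)
      (mem_collapsed.2 (le_goldie_of_isEssentialIn he))
  have hs' : I.fst ⋖ I.snd := hs
  rcases hs'.eq_or_eq hx hx' with h | h
  · exact le_antisymm hcd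
      (collapsed_projective ⊥ hp (show ival I.fst x hx ∈ collapsed ⊥ from h.le))
  · subst h
    exact absurd h1 hcon.2

theorem goldie_le_neg_goldman : goldie A ≤ neg (goldman A) := by
  rw [le_neg_comm]
  refine xi_le ?_
  rintro I ⟨hn, hs⟩
  rw [collapsed_neg]
  intro J hJ hJg
  rcases hs.eq_or_eq hJ with h | h
  · exact h
  · subst h
    exact eq_of_isNonsingular_of_collapsed hn hJg

/-- `¬ ξ_sp` collapses the intervals that have no nonsingular simple subinterval. -/
theorem collapsed_neg_goldman :
    collapsed (neg (goldman A)) =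
      {I | ∀ J, J ≤ I → IsSimpleInterval J → ¬ IsNonsingular J} := by
  refine Set.Subset.antisymm (fun I hI J hJ hs hn => ?_) ?_
  · rw [collapsed_neg] at hI
    exact (show J.fst ⋖ J.snd from hs).ne (hI J hJ (subset_collapsed_xi _ ⟨hn, hs⟩))
  -- Trivial intervals are added because the family must be closed under initial parts; they do not
  -- change its torsion set.
  obtain ⟨k, hk⟩ := exists_torsion_nucleus
    {I : NonemptyInterval A | (IsNonsingular I ∧ IsSimpleInterval I) ∨ I.fst = I.snd}
    (by
      rintro I J h (⟨hn, hs⟩ | ht)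
      · exact Or.inl ⟨nonsingular_similar h hn, isSimpleInterval_similar h hs⟩
      · exact Or.inr (le_antisymm J.fst_le_snd
          (collapsed_similar ⊥ h (show I ∈ collapsed ⊥ from ht.ge))))
    (by
      rintro a x b h h' (⟨hn, hs⟩ | ht)
      · rcases hs.eq_or_eq (ival_le (h := h.trans h') (h' := h) le_rfl h') with e | e
        · exact Or.inr e
        · exact Or.inl (e ▸ ⟨hn, hs⟩)
      · exact Or.inr (le_antisymm h (h'.trans (show a = b from ht).ge)))
  have hkx : k ≤ neg (goldman A) := by
    rw [le_neg_comm]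
    refine xi_le fun I hI => ?_
    rw [collapsed_neg]
    intro J hJ hJk
    rcases hI.2.eq_or_eq hJ with h | h
    · exact h
    · subst h
      rw [hk] at hJk
      exact hJk J le_rfl (Or.inl hI)
  intro I hI
  have h1 : I ∈ collapsed k := by
    rw [hk]
    rintro J hJ (⟨hn, hs⟩ | ht)
    · exact absurd hn (hI J hJ hs)
    · exact ht
  exact le_trans h1 (hkx I.fst)

/-! ### The two implications. -/

theorem neg_goldman_le_goldie (hA : IsWeaklyAtomicIdiom A) (h : IsDDF (goldie A)) :
    neg (goldman A) ≤ goldie A := by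
  refine le_of_collapsed_subset ?_
  rw [collapsed_neg_goldman]
  rintro ⟨⟨a, b⟩, hab⟩ hI
  change a ≤ b at hab
  let X : Set A := {x | a ≤ x ∧ ∃ hx : x ≤ b, ival x b hx ∈ collapsed (goldie A)}
  have hbX : b ∈ X := ⟨hab, le_rfl, mem_collapsed.2 (goldie A).le_apply⟩
  have hmb : sInf X ≤ b := sInf_le hbX
  -- Closure under meets makes `sInf X` the least element of `X`.
  have hm : ival (sInf X) b hmb ∈ collapsed (goldie A) := h.2.2 X b hmb fun x hx => hx.2
  have ham : a ≤ sInf X := le_sInf fun x hx => hx.1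
  rcases ham.eq_or_lt with he | hlt
  · rw [← ival_congr (h := hab) he rfl] at hm
    exact hm
  exfalso
  obtain ⟨u, v, huv, hau, hvm, hs⟩ := hA (ival a b hab) a (sInf X) le_rfl hlt hmb
  have hcov : u ⋖ v := hs
  have hc : v ≤ goldie A u :=
    (isNonsingular_or_collapsed hs).resolve_left
      (hI _ (ival_le (h := hab) hau (hvm.trans hmb)) hs)
  -- Maximality of `z` makes `z ⊔ v` essential in `[z, sInf X]`, so that stability extends the
  -- collapse of `[z, z ⊔ v]` to `[z, sInf X]`.
  obtain ⟨z, ⟨huz, hzm, hzv⟩, hmax⟩ := exists_maximal_inf_eq huv (huv.trans hvm)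
  have hzs : z ⊔ v ≤ goldie A z :=
    sup_le (goldie A).le_apply (hc.trans ((goldie A).monotone huz))
  have hess : IsEssentialIn (z ⊔ v) (ival z (sInf X) (le_sup_left.trans (sup_le hzm hvm))) := by
    refine ⟨⟨le_sup_left, sup_le hzm hvm⟩, fun y hy hym hyz => ?_⟩
    change z ≤ y at hy
    change (z ⊔ v) ⊓ y = z at hyz
    -- If `y ⊓ v = u`, maximality gives `y ≤ z`; if `y ⊓ v = v`, then `v ≤ (z ⊔ v) ⊓ y = z`, against
    -- `z ⊓ v = u`.
    rcases hcov.eq_or_eq (le_inf (huz.trans hy) huv) inf_le_right with e | e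
    · exact le_antisymm (hmax ⟨huz.trans hy, hym, e⟩ hy) hy
    · have hvz : v ≤ z := (le_inf le_sup_right (inf_eq_right.1 e)).trans hyz.le
      exact absurd (hzv.symm.trans (inf_eq_right.2 hvz)) hcov.ne
  have hzm' : sInf X ≤ goldie A z :=
    h.2.1 z (z ⊔ v) (sInf X) le_sup_left (sup_le hzm hvm) (mem_collapsed.2 hzs) hess
  have hzX : z ∈ X := by
    refine ⟨hau.trans huz, hzm.trans hmb, mem_collapsed.2 ?_⟩
    calc b ≤ goldie A (sInf X) := hm
      _ ≤ goldie A (goldie A z) := (goldie A).monotone hzm'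
      _ = goldie A z := (goldie A).idempotent z
  -- Now `v ≤ sInf X ≤ z`, so `z ⊓ v = u` collapses to `v = u`.
  exact hcov.ne (hzv.symm.trans (inf_eq_right.2 (hvm.trans (sInf_le hzX))))

theorem isDDF_goldie_of_neg_goldman_eq (h : neg (goldman A) = goldie A) :
    IsDDF (goldie A) := by
  refine ⟨isDivisionSet_collapsed _, isStableSet_collapsed_goldie, fun X a ha hX => ?_⟩
  rw [← h, collapsed_neg_goldman]
  rintro ⟨⟨u, v⟩, huv⟩ hJ hs hn
  change u ≤ v at huv
  rw [NonemptyInterval.le_def] at hJ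
  have hXu : sInf X ≤ u := hJ.1
  have hva : v ≤ a := hJ.2
  have hcov : u ⋖ v := hs
  obtain ⟨y, hyv, hy0, hy1⟩ := exists_similar_bot (huv := huv) hn hs
  have hyX : y ≤ sInf X := by
    refine le_sInf fun x hx => ?_
    obtain ⟨hxa, hxc⟩ := hX x hx
    rw [mem_collapsed] at hxc
    have h1 : ival (x ⊓ y) y inf_le_right ∈ collapsed (goldie A) :=
      collapsed_similar _ ⟨x, y, Or.inr ⟨rfl, rfl⟩⟩
        (mem_collapsed.2 (sup_le (goldie A).le_apply ((hyv.trans hva).trans hxc)))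
    have hsim : Similar (ival (u ⊓ y) y inf_le_right) (ival u (u ⊔ y) le_sup_left) :=
      ⟨u, y, Or.inr ⟨rfl, rfl⟩⟩
    have hI : ival u (u ⊔ y) le_sup_left = ival u v huv := ival_congr rfl hy1
    rw [hI] at hsim
    have hsy : u ⊓ y ⋖ y := isSimpleInterval_similar hsim hs
    -- As `[⊥, y]` is simple, `x ⊓ y` is `⊥` or `y`. The value `⊥` would make the nontrivial
    -- nonsingular interval `[⊥, y]` collapsed.
    rcases hsy.eq_or_eq (by rw [hy0]; exact bot_le) (inf_le_right : x ⊓ y ≤ y) with e | e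
    · rw [ival_congr e rfl] at h1
      exact absurd (eq_of_isNonsingular_of_collapsed (nonsingular_similar hsim hn) h1) hsy.ne
    · exact inf_eq_right.1 e
  exact hcov.ne ((sup_eq_left.2 (hyX.trans hXu)).symm.trans hy1)

end Goldie

end IdiomTheory

theorem mainTheorem10 (A : Type*) [CompleteLattice A] [IsIdiom A]
    (hA : IdiomTheory.IsWeaklyAtomicIdiom A) :
    IdiomTheory.IsDDF (IdiomTheory.goldie A) ↔
      IdiomTheory.neg (IdiomTheory.goldman A) = IdiomTheory.goldie A :=
  ⟨fun h => le_antisymm (IdiomTheory.neg_goldman_le_goldie hA h)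
    IdiomTheory.goldie_le_neg_goldman, IdiomTheory.isDDF_goldie_of_neg_goldman_eq⟩
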